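/- Let $Z$ be a separable real Banach space with dual $\mathcal Z=Z^*$, and equip $[0,1]$ with Lebesgue measure. For $p\ge 1$, an $L^p_{\mathcal Z}$-kernel is a symmetric function $W:[0,1]^2\to\mathcal Z$ that is weak-* measurable (that is, $(x,y)\mapsto\langle f,W(x,y)\rangle$ is Lebesgue measurable for every $f\in Z$) and for which $(x,y)\mapsto\|W(x,y)\|_{\mathcal Z}$ lies in $L^p([0,1]^2)$; write $\|W\|_q=\left(\int_{[0,1]^2}\|W(x,y)\|_{\mathcal Z}^q\,dx\,dy\right)^{1/q}$ for $1\le q\le p$. The cut norm of a function $W:[0,1]^2\to\mathcal Z$ for which the integrals exist is $$\|W\|_\square=\sup_{\|f\|_Z=1}\ \sup_{S,T\subseteq[0,1]}\left|\int_{S\times T}\langle f,W(x,y)\rangle\,dx\,dy\right|,$$ where $S,T$ range over the measurable subsets of $[0,1]$ (and $\|W\|_\square=0$ if $Z=\{0\}$). Let $k\ge 2$ be an integer, $p>2$ a real number, $\gamma\in(1/p,1/2)$, and $U$ an $L^p_{\mathcal Z}$-kernel. Let $X_1,\dots,X_k$ be independent random variables, uniformly distributed on $[0,1]$, and let $\mathcal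 U_X:[0,1]^2\to\mathcal Z$ be the step function with value $U(X_i,X_j)$ on $\left[\tfrac{i-1}k,\tfrac ik\right)\times\left[\tfrac{j-1}k,\tfrac jk\right)$ for $i\ne j$, and $0$ elsewhere (in particular on the diagonal cells). Then with probability at least $1-3k^{1-\gamma p}$, $$\|\mathcal U_X\|_\square-\|U\|_\square\ \ge\ -\left(\|U\|_\square+\sqrt{18(\gamma p-1)}\,\bigl(\|U\|_1+2\|U\|_p\bigr)\right)k^{-1/2+\gamma}\sqrt{\ln k}.$$ -/

import Mathlib

open MeasureTheory ProbabilityTheory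

noncomputable section

namespace VectorKernel

/-- The cut norm of a real valued function on the unit square: the supremum of
`|∫_{S × T} W|` over all measurable `S, T ⊆ [0,1]`. -/
def realCutNorm (W : unitInterval → unitInterval → ℝ) : ℝ :=
  sSup {r : ℝ | ∃ S T : Set unitInterval, MeasurableSet S ∧ MeasurableSet T ∧
    r = |∫ q in S ×ˢ T, W q.1 q.2|}

variable {Z : Type*} [NormedAddCommGroup Z] [NormedSpace ℝ Z]

/-- The cut norm of a function on the unit square with values in the dual of `Z`: the supremum of
the cut norms of the real valued functions `⟨f, W⟩` over the unit sphere of `Z`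
(it is `0` when `Z = 0`). -/
def cutNorm (W : unitInterval → unitInterval → StrongDual ℝ Z) : ℝ :=
  sSup {r : ℝ | ∃ f : Z, ‖f‖ = 1 ∧ r = realCutNorm (fun x y => W x y f)}

/-- `‖W‖_p = (∫ ‖W(x,y)‖^p)^(1/p)`, the integral being over the unit square and the norm inside
being the dual norm. -/
def kernelLpNorm (p : ℝ) (W : unitInterval → unitInterval → StrongDual ℝ Z) : ℝ :=
  (∫ q : unitInterval × unitInterval, ‖W q.1 q.2‖ ^ p) ^ (1 / p)

/-- `L^p` kernels with values in the dual of `Z`: symmetric functions on the unit square that are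
weak-* (Lebesgue) measurable and whose norm function is in `L^p`. -/
structure IsLpKernel (p : ℝ) (W : unitInterval → unitInterval → StrongDual ℝ Z) : Prop where
  symm : ∀ x y, W x y = W y x
  weakStar_measurable : ∀ f : Z,
    AEMeasurable (fun q : unitInterval × unitInterval => W q.1 q.2 f) volume
  memLp : MemLp (fun q : unitInterval × unitInterval => ‖W q.1 q.2‖) (ENNReal.ofReal p) volume

/-- The `i`-th (counting from `0`) of the `k` steps `[i/k, (i+1)/k)` of length `1/k` in `[0,1]`. -/
def step (k : ℕ) (i : Fin k) : Set unitInterval :=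
  {x | ((i : ℕ) : ℝ) / k ≤ (x : ℝ) ∧ (x : ℝ) < (((i : ℕ) : ℝ) + 1) / k}

open scoped Classical in
/-- The sample of `U` at `x_1, …, x_k`: the step function with uniform steps of length `1/k` whose
value on the `(i,j)` cell is `U(x_i, x_j)` for `i ≠ j`, and `0` on the diagonal cells. -/
def sample {k : ℕ} (U : unitInterval → unitInterval → StrongDual ℝ Z) (x : Fin k → unitInterval) :
    unitInterval → unitInterval → StrongDual ℝ Z :=
  fun s t => ∑ i : Fin k, ∑ j : Fin k,
    if i ≠ j ∧ s ∈ step k i ∧ t ∈ step k j then U (x i) (x j) else 0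

end VectorKernel

end

/-!
The lower bound needs only one good test of the sample. A vector `f` and a rectangle `S × T` that
are nearly optimal for the cut norm of `U` induce a rectangle that tests the sample: take the steps
`i` with `X i ∈ S` and the steps `j` with `X j ∈ T` (`abs_pairAverage_le_cutNorm_sample`). The value
of this test is `1 - 1/k` times the average, over the pairs `i ≠ j`, of `F (X i, X j)`, where
`F = 1_{S × T} ⟨f, U⟩` has integral close to `± ‖U‖_□`. Everything thus reduces to the lower tail of
one average over pairs (a U-statistic of order two) of a function `F` in `L^p`, `p > 2`.

Since `F` is unbounded, the exponential moments are self-normalised. The inequality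
`exp (x - x²/2) ≤ 1 + x + x²/2` shows that `exp (θ (E F - F) - θ²/2 (F² + E F²))` has expectation at
most `1` for every square integrable `F` (`lintegral_exp_selfNormalized_le`). Following Hoeffding,
the average over all pairs is an average over permutations of averages of `⌊k/2⌋` independent terms,
so that convexity of `exp` carries the bound over to the average over pairs
(`lintegral_exp_pairAverage_le`). Chernoff's bound then applies as long as the empirical second
moment of `F` is at most `(k^γ ‖U‖_p)²`, and this fails with probability at most `k^{-γ p}` by
Markov's inequality of order `p / 2` (`measure_pairAverage_le`).

The loss of `‖U‖_□ / k` from the empty diagonal and the gap between a near-optimal test and an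
optimal one are absorbed by the term `‖U‖_□ k^{-1/2+γ} √(ln k)`, because
`1 / k < k^{-1/2+γ} √(ln k)` for `k ≥ 2`.
-/

namespace VectorKernel

/-! ### Averaging over ordered pairs of distinct indices -/

/-- The average of `φ i j` over the ordered pairs of distinct indices `i, j : Fin k`. -/
noncomputable def pairAverage {k : ℕ} (φ : Fin k → Fin k → ℝ) : ℝ :=
  ((k : ℝ) * (k - 1))⁻¹ * ∑ i, ∑ j, if i ≠ j then φ i j else 0

theorem sum_sum_ite_ne_const (k : ℕ) (c : ℝ) :
    (∑ i : Fin k, ∑ j : Fin k, if i ≠ j then c else 0) = (k * (k - 1)) * c := by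
  have h : ∀ i : Fin k, (∑ j : Fin k, if i ≠ j then c else 0) = (k - 1) * c := by
    intro i
    have : ∀ j : Fin k, (if i ≠ j then c else 0) = c - if i = j then c else 0 := by
      intro j; split_ifs <;> simp_all
    simp only [this, Finset.sum_sub_distrib, Finset.sum_const, Finset.card_univ, Fintype.card_fin,
      nsmul_eq_mul, Finset.sum_ite_eq, Finset.mem_univ, if_true]
    ring
  simp only [h, Finset.sum_const, Finset.card_univ, Fintype.card_fin, nsmul_eq_mul]
  ring

theorem exists_perm_apply_eq_apply_eq {α : Type*} [DecidableEq α] {a b a' b' : α} (h : a ≠ b)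
    (h' : a' ≠ b') : ∃ τ : Equiv.Perm α, τ a = a' ∧ τ b = b' := by
  refine ⟨(Equiv.swap a a').trans (Equiv.swap (Equiv.swap a a' b) b'), ?_, by simp⟩
  have h1 : a' ≠ Equiv.swap a a' b := by
    intro e
    have := congrArg (Equiv.swap a a') e
    simp at this
    exact h this
  simp [Equiv.swap_apply_of_ne_of_ne h1 h']

/-- The average over pairs of distinct indices is the average, over all permutations, of the value
at the image of one fixed pair: by 2-transitivity the latter does not depend on the pair. -/
theorem pairAverage_eq_perm {k : ℕ} (hk : 2 ≤ k) (φ : Fin k → Fin k → ℝ) {a b : Fin k}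
    (hab : a ≠ b) :
    pairAverage φ = ((k.factorial : ℝ))⁻¹ * ∑ σ : Equiv.Perm (Fin k), φ (σ a) (σ b) := by
  have hk' : (2 : ℝ) ≤ k := by exact_mod_cast hk
  have h1 : ∀ i j : Fin k, i ≠ j →
      ∑ σ : Equiv.Perm (Fin k), φ (σ i) (σ j) = ∑ σ : Equiv.Perm (Fin k), φ (σ a) (σ b) := by
    intro i j hij
    obtain ⟨τ, rfl, rfl⟩ := exists_perm_apply_eq_apply_eq hab hij
    exact Fintype.sum_equiv (Equiv.mulRight τ) _ _ fun σ => by simp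
  -- Double count the sum of `φ (σ i) (σ j)` over all `σ` and all `i ≠ j`.
  have h2 : (∑ i : Fin k, ∑ j : Fin k, if i ≠ j then
        ∑ σ : Equiv.Perm (Fin k), φ (σ i) (σ j) else 0)
      = (k * (k - 1)) * ∑ σ : Equiv.Perm (Fin k), φ (σ a) (σ b) := by
    rw [← sum_sum_ite_ne_const]
    refine Finset.sum_congr rfl fun i _ => Finset.sum_congr rfl fun j _ => ?_
    split_ifs with h
    · exact h1 i j h
    · rfl
  have h3 : (∑ i : Fin k, ∑ j : Fin k, if i ≠ j then
        ∑ σ : Equiv.Perm (Fin k), φ (σ i) (σ j) else 0)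
      = k.factorial * ∑ i : Fin k, ∑ j : Fin k, if i ≠ j then φ i j else 0 := by
    have : ∀ i j : Fin k, (if i ≠ j then
        ∑ σ : Equiv.Perm (Fin k), φ (σ i) (σ j) else 0)
        = ∑ σ : Equiv.Perm (Fin k), if σ i ≠ σ j then φ (σ i) (σ j) else 0 := by
      intro i j
      by_cases h : i = j <;> simp [h]
    simp only [this]
    rw [Finset.sum_congr rfl fun i _ => Finset.sum_comm, Finset.sum_comm]
    have h4 : ∀ σ : Equiv.Perm (Fin k),
        (∑ i : Fin k, ∑ j : Fin k, if σ i ≠ σ j then φ (σ i) (σ j) else 0)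
        = ∑ i : Fin k, ∑ j : Fin k, if i ≠ j then φ i j else 0 := by
      intro σ
      rw [← Equiv.sum_comp σ (fun i => ∑ j : Fin k, if i ≠ j then φ i j else 0)]
      exact Finset.sum_congr rfl fun i _ =>
        Equiv.sum_comp σ (fun j => if σ i ≠ j then φ (σ i) j else 0)
    simp only [h4, Finset.sum_const, Finset.card_univ, Fintype.card_perm, Fintype.card_fin,
      nsmul_eq_mul]
  have hf : (k.factorial : ℝ) ≠ 0 := by exact_mod_cast k.factorial_ne_zero
  have hk1 : (k : ℝ) * (k - 1) ≠ 0 := by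
    have : (0 : ℝ) < k * (k - 1) := by nlinarith
    exact this.ne'
  rw [pairAverage, inv_mul_eq_iff_eq_mul₀ hk1, mul_left_comm, eq_inv_mul_iff_mul_eq₀ hf, ← h3, h2]

/-! ### Exponential moments of averages over pairs -/

variable {Ω 𝒳 : Type*} [MeasurableSpace Ω] [MeasurableSpace 𝒳]

/-- Functions of pairwise disjoint pairs of independent variables have multiplicative
expectations. -/
theorem lintegral_prod_pairs {P : Measure Ω} {ι ρ : Type*}
    {X : ι → Ω → 𝒳} (hX : iIndepFun X P) (hm : ∀ i, Measurable (X i)) {a b : ρ → ι}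
    (ha : Function.Injective a) (hb : Function.Injective b) (hab : ∀ r s, a r ≠ b s)
    {g : 𝒳 × 𝒳 → ENNReal} (hg : Measurable g) (s : Finset ρ) :
    ∫⁻ ω, ∏ r ∈ s, g (X (a r) ω, X (b r) ω) ∂P
      = ∏ r ∈ s, ∫⁻ ω, g (X (a r) ω, X (b r) ω) ∂P := by
  classical
  have : IsProbabilityMeasure P := hX.isProbabilityMeasure
  induction s using Finset.cons_induction with
  | empty => simp
  | cons j s hj ih =>
    simp only [Finset.prod_cons, ← ih]
    let T₁ : Finset ι := {a j, b j}
    let T₂ : Finset ι := s.image a ∪ s.image b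
    have hT : Disjoint T₁ T₂ := by
      rw [Finset.disjoint_left]
      intro i hi hi'
      simp only [T₁, T₂, Finset.mem_insert, Finset.mem_singleton, Finset.mem_union,
        Finset.mem_image] at hi hi'
      rcases hi with rfl | rfl <;> rcases hi' with ⟨r, hr, h⟩ | ⟨r, hr, h⟩
      · exact hj (ha h ▸ hr)
      · exact hab _ _ h.symm
      · exact hab _ _ h
      · exact hj (hb h ▸ hr)
    have ha₂ : ∀ r : s, a r ∈ T₂ := fun r =>
      Finset.mem_union_left _ (Finset.mem_image_of_mem _ r.2)
    have hb₂ : ∀ r : s, b r ∈ T₂ := fun r =>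
      Finset.mem_union_right _ (Finset.mem_image_of_mem _ r.2)
    have hind := (hX.indepFun_finset T₁ T₂ hT hm).comp
      (φ := fun z : T₁ → 𝒳 => g (z ⟨a j, by simp [T₁]⟩, z ⟨b j, by simp [T₁]⟩))
      (ψ := fun z : T₂ → 𝒳 => ∏ r ∈ s.attach, g (z ⟨a r, ha₂ r⟩, z ⟨b r, hb₂ r⟩))
      (by fun_prop) (Finset.measurable_fun_prod _ fun r _ => by fun_prop)
    have h2 : ∀ ω, ∏ r ∈ s, g (X (a r) ω, X (b r) ω)
        = ∏ r ∈ s.attach, g (X (a r) ω, X (b r) ω) := fun ω =>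
      (Finset.prod_attach s fun r => g (X (a r) ω, X (b r) ω)).symm
    simp only [h2]
    refine lintegral_mul_eq_lintegral_mul_lintegral_of_indepFun'' ?_ ?_ hind
    · exact (hg.comp ((hm _).prodMk (hm _))).aemeasurable
    · exact (Finset.measurable_fun_prod _ fun r _ =>
        hg.comp ((hm _).prodMk (hm _))).aemeasurable

/-- Two independent variables with law `ν` have joint law `ν ⊗ ν`. -/
theorem measurePreserving_pair {P : Measure Ω} {ν : Measure 𝒳} [IsProbabilityMeasure ν]
    {ι : Type*} {X : ι → Ω → 𝒳} (hX : iIndepFun X P)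
    (hm : ∀ i, Measurable (X i)) (hν : ∀ i, P.map (X i) = ν) {i j : ι} (hij : i ≠ j) :
    MeasurePreserving (fun ω => (X i ω, X j ω)) P (ν.prod ν) := by
  have : IsProbabilityMeasure P := hX.isProbabilityMeasure
  refine ⟨(hm i).prodMk (hm j), ?_⟩
  rw [(hX.indepFun hij).map_prod_eq_prod_map_map (hm i).aemeasurable (hm j).aemeasurable, hν, hν]

/-- Hoeffding's averaging argument: the average of `G` over all pairs is an average, over the
permutations `σ`, of averages of `⌊k/2⌋` independent terms `G (X (σ (2r)), X (σ (2r+1)))`, and the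
exponential function is convex. -/
theorem lintegral_exp_pairAverage_le {P : Measure Ω} {ν : Measure 𝒳} [IsProbabilityMeasure ν]
    {k : ℕ} (hk : 2 ≤ k) {X : Fin k → Ω → 𝒳} (hX : iIndepFun X P)
    (hm : ∀ i, Measurable (X i)) (hν : ∀ i, P.map (X i) = ν) {G : 𝒳 × 𝒳 → ℝ} (hG : Measurable G)
    (hG1 : ∫⁻ q, ENNReal.ofReal (Real.exp (G q)) ∂(ν.prod ν) ≤ 1) :
    ∫⁻ ω, ENNReal.ofReal (Real.exp (((k / 2 : ℕ) : ℝ) *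
      pairAverage fun i j => G (X i ω, X j ω))) ∂P ≤ 1 := by
  have hf : (0 : ℝ) < k.factorial := by exact_mod_cast k.factorial_pos
  let a : Fin (k / 2) → Fin k := fun r => ⟨2 * r, by omega⟩
  let b : Fin (k / 2) → Fin k := fun r => ⟨2 * r + 1, by omega⟩
  have ha : Function.Injective a := fun r s h => by
    simp only [a, Fin.mk.injEq] at h; omega
  have hb : Function.Injective b := fun r s h => by
    simp only [b, Fin.mk.injEq] at h; omega
  have hab : ∀ r s, a r ≠ b s := fun r s h => by
    simp only [a, b, Fin.mk.injEq] at h; omega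
  have key : ∀ ω, Real.exp (((k / 2 : ℕ) : ℝ) * pairAverage fun i j => G (X i ω, X j ω))
      ≤ ∑ σ : Equiv.Perm (Fin k), (k.factorial : ℝ)⁻¹ *
        Real.exp (∑ r, G (X (σ (a r)) ω, X (σ (b r)) ω)) := by
    intro ω
    have h1 : ((k / 2 : ℕ) : ℝ) * pairAverage (fun i j => G (X i ω, X j ω))
        = ∑ σ : Equiv.Perm (Fin k), (k.factorial : ℝ)⁻¹ *
          ∑ r, G (X (σ (a r)) ω, X (σ (b r)) ω) := by
      calc _ = ∑ r : Fin (k / 2), pairAverage (fun i j => G (X i ω, X j ω)) := by simp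
        _ = ∑ r : Fin (k / 2), ((k.factorial : ℝ))⁻¹ *
            ∑ σ : Equiv.Perm (Fin k), G (X (σ (a r)) ω, X (σ (b r)) ω) :=
          Finset.sum_congr rfl fun r _ => pairAverage_eq_perm hk _ (hab r r)
        _ = _ := by
          rw [← Finset.mul_sum, ← Finset.mul_sum, Finset.sum_comm]
    rw [h1]
    have := convexOn_exp.map_sum_le (t := (Finset.univ : Finset (Equiv.Perm (Fin k))))
      (w := fun _ => (k.factorial : ℝ)⁻¹)
      (p := fun σ => ∑ r, G (X (σ (a r)) ω, X (σ (b r)) ω)) (fun _ _ => by positivity)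
      (by simp [Finset.card_univ, Fintype.card_perm, hf.ne']) (fun _ _ => Set.mem_univ _)
    simpa only [smul_eq_mul] using this
  have hpair : ∀ i j : Fin k, Measurable fun ω => (X i ω, X j ω) := fun i j => (hm i).prodMk (hm j)
  calc _ ≤ ∫⁻ ω, ∑ σ : Equiv.Perm (Fin k), ENNReal.ofReal (k.factorial : ℝ)⁻¹ *
        ∏ r, ENNReal.ofReal (Real.exp (G (X (σ (a r)) ω, X (σ (b r)) ω))) ∂P := by
        refine lintegral_mono fun ω => (ENNReal.ofReal_le_ofReal (key ω)).trans_eq ?_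
        rw [ENNReal.ofReal_sum_of_nonneg fun _ _ => by positivity]
        refine Finset.sum_congr rfl fun σ _ => ?_
        rw [ENNReal.ofReal_mul (by positivity), Real.exp_sum,
          ENNReal.ofReal_prod_of_nonneg fun _ _ => (Real.exp_pos _).le]
    _ = ∑ σ : Equiv.Perm (Fin k), ENNReal.ofReal (k.factorial : ℝ)⁻¹ *
        ∫⁻ ω, ∏ r, ENNReal.ofReal (Real.exp (G (X (σ (a r)) ω, X (σ (b r)) ω))) ∂P := by
        have hmeas : ∀ σ : Equiv.Perm (Fin k), Measurable fun ω =>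
            ∏ r, ENNReal.ofReal (Real.exp (G (X (σ (a r)) ω, X (σ (b r)) ω))) := fun σ =>
          Finset.measurable_fun_prod _ fun r _ => (hG.comp (hpair _ _)).exp.ennreal_ofReal
        rw [lintegral_finsetSum _ fun σ _ => (hmeas σ).const_mul _]
        exact Finset.sum_congr rfl fun σ _ => lintegral_const_mul _ (hmeas σ)
    _ ≤ ∑ σ : Equiv.Perm (Fin k), ENNReal.ofReal (k.factorial : ℝ)⁻¹ * 1 := by
        refine Finset.sum_le_sum fun σ _ => ?_
        gcongr
        rw [lintegral_prod_pairs hX hm (a := fun r => σ (a r)) (b := fun r => σ (b r))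
          (σ.injective.comp ha) (σ.injective.comp hb) (fun r s h => hab r s (σ.injective h))
          (g := fun q => ENNReal.ofReal (Real.exp (G q))) hG.exp.ennreal_ofReal]
        refine Finset.prod_le_one' fun r _ => ?_
        rw [(measurePreserving_pair hX hm hν (σ.injective.ne (hab r r))).lintegral_comp
          (f := fun q => ENNReal.ofReal (Real.exp (G q))) hG.exp.ennreal_ofReal]
        exact hG1
    _ = 1 := by
        simp only [mul_one, Finset.sum_const, Finset.card_univ, Fintype.card_perm,
          Fintype.card_fin, nsmul_eq_mul]
        rw [ENNReal.ofReal_inv_of_pos hf, ENNReal.ofReal_natCast]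
        exact ENNReal.mul_inv_cancel (by exact_mod_cast k.factorial_ne_zero)
          (ENNReal.natCast_ne_top _)

/-- An elementary inequality which makes the exponential moment of `x - x²/2` finite whatever the
upper tail of `x`. -/
theorem exp_sub_half_sq_le (x : ℝ) : Real.exp (x - x ^ 2 / 2) ≤ 1 + x + x ^ 2 / 2 := by
  rcases le_total 0 x with hx | hx
  · have h1 := Real.le_log_one_add_of_nonneg hx
    have h2 : x - x ^ 2 / 2 ≤ 2 * x / (x + 2) := by
      rw [le_div_iff₀ (by linarith)]
      nlinarith [pow_nonneg hx 3]
    calc Real.exp (x - x ^ 2 / 2) ≤ Real.exp (Real.log (1 + x)) :=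
          Real.exp_le_exp.2 (h2.trans h1)
      _ = 1 + x := Real.exp_log (by linarith)
      _ ≤ _ := by nlinarith [sq_nonneg x]
  -- For `x ≤ 0` use `exp (-(x - x²/2)) ≥ 1 - x + x²/2` and
  -- `(1 + x²/2 - x) (1 + x²/2 + x) = 1 + x⁴/4`.
  · have h1 := Real.add_one_le_exp (-(x - x ^ 2 / 2))
    have h3 : 0 < 1 - x + x ^ 2 / 2 := by nlinarith [sq_nonneg x]
    have h4 : 0 < 1 + x + x ^ 2 / 2 := by nlinarith [sq_nonneg (x + 1)]
    have h5 : Real.exp (x - x ^ 2 / 2) * Real.exp (-(x - x ^ 2 / 2)) = 1 := by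
      rw [← Real.exp_add]; simp
    have h6 := Real.exp_pos (x - x ^ 2 / 2)
    have h7 : Real.exp (x - x ^ 2 / 2) * (1 - x + x ^ 2 / 2) ≤ 1 := by
      rw [← h5]; gcongr; linarith
    have h8 : 1 ≤ (1 + x + x ^ 2 / 2) * (1 - x + x ^ 2 / 2) := by nlinarith [sq_nonneg (x ^ 2)]
    exact le_of_mul_le_mul_right (h7.trans h8) h3

/-- Self-normalised exponential moment bound, valid for every square integrable `F`. -/
theorem lintegral_exp_selfNormalized_le {μ : Measure Ω} [IsProbabilityMeasure μ] {F : Ω → ℝ}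
    (hF : MemLp F 2 μ) (θ : ℝ) :
    ∫⁻ q, ENNReal.ofReal (Real.exp (θ * ((∫ z, F z ∂μ) - F q)
      - θ ^ 2 / 2 * (F q ^ 2 + ∫ z, F z ^ 2 ∂μ))) ∂μ ≤ 1 := by
  have hi1 : Integrable F μ := hF.integrable (by norm_num)
  have hi2 : Integrable (fun z => F z ^ 2) μ := hF.integrable_sq
  set M := ∫ z, F z ∂μ
  set w := ∫ z, F z ^ 2 ∂μ
  let K : Ω → ℝ := fun q => 1 + -θ * F q + θ ^ 2 / 2 * F q ^ 2
  have hKi : Integrable K μ := ((integrable_const _).add (hi1.const_mul _)).add (hi2.const_mul _)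
  have hK : ∀ q, Real.exp (-θ * F q - θ ^ 2 / 2 * F q ^ 2) ≤ K q := fun q => by
    have := exp_sub_half_sq_le (-θ * F q)
    convert this using 2 <;> ring
  have hKint : ∫ q, K q ∂μ = 1 - θ * M + θ ^ 2 / 2 * w := by
    have hi3 : Integrable (fun q => 1 + -θ * F q) μ := (integrable_const _).add (hi1.const_mul _)
    simp only [K]
    rw [integral_add hi3 (hi2.const_mul _), integral_add (integrable_const _) (hi1.const_mul _),
      integral_const_mul, integral_const_mul]
    simp [M, w]
    ring
  calc _ ≤ ∫⁻ q, ENNReal.ofReal (Real.exp (θ * M - θ ^ 2 / 2 * w)) * ENNReal.ofReal (K q) ∂μ := by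
        refine lintegral_mono fun q => ?_
        rw [← ENNReal.ofReal_mul (Real.exp_pos _).le]
        refine ENNReal.ofReal_le_ofReal ?_
        have : θ * (M - F q) - θ ^ 2 / 2 * (F q ^ 2 + w)
          = (θ * M - θ ^ 2 / 2 * w) + (-θ * F q - θ ^ 2 / 2 * F q ^ 2) := by ring
        rw [this, Real.exp_add]
        gcongr
        exact hK q
    _ = ENNReal.ofReal (Real.exp (θ * M - θ ^ 2 / 2 * w) * (1 - θ * M + θ ^ 2 / 2 * w)) := by
        rw [lintegral_const_mul' _ _ ENNReal.ofReal_ne_top, ← hKint,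
          ← ofReal_integral_eq_lintegral_ofReal hKi
            (ae_of_all _ fun q => (Real.exp_pos _).le.trans (hK q)),
          ENNReal.ofReal_mul (Real.exp_pos _).le]
    _ ≤ 1 := by
        rw [ENNReal.ofReal_le_one]
        have h1 := Real.add_one_le_exp (-(θ * M - θ ^ 2 / 2 * w))
        calc _ ≤ Real.exp (θ * M - θ ^ 2 / 2 * w) * Real.exp (-(θ * M - θ ^ 2 / 2 * w)) := by
              gcongr; linarith
          _ = 1 := by rw [← Real.exp_add]; simp

/-! ### The lower tail of averages over pairs -/

theorem pairAverage_add_add_const {k : ℕ} (hk : 2 ≤ k) (φ ψ : Fin k → Fin k → ℝ) (a b c : ℝ) :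
    pairAverage (fun i j => a * φ i j + b * ψ i j + c)
      = a * pairAverage φ + b * pairAverage ψ + c := by
  have hf : (k.factorial : ℝ) ≠ 0 := by exact_mod_cast k.factorial_ne_zero
  have h01 : (⟨0, by omega⟩ : Fin k) ≠ ⟨1, by omega⟩ := by simp
  simp only [pairAverage_eq_perm hk _ h01, Finset.sum_add_distrib, ← Finset.mul_sum,
    Finset.sum_const, Finset.card_univ, Fintype.card_perm, Fintype.card_fin, nsmul_eq_mul]
  field_simp

theorem measurable_pairAverage {k : ℕ} {φ : Ω → Fin k → Fin k → ℝ}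
    (h : ∀ i j, Measurable fun ω => φ ω i j) : Measurable fun ω => pairAverage (φ ω) := by
  unfold pairAverage
  refine Measurable.const_mul (Finset.measurable_fun_sum _ fun i _ =>
    Finset.measurable_fun_sum _ fun j _ => ?_) _
  split_ifs
  · exact h i j
  · exact measurable_const

theorem pairAverage_rpow_le {k : ℕ} (hk : 2 ≤ k) {φ : Fin k → Fin k → ℝ} (h : ∀ i j, 0 ≤ φ i j)
    {r : ℝ} (hr : 1 ≤ r) : pairAverage φ ^ r ≤ pairAverage fun i j => φ i j ^ r := by
  have hf : (k.factorial : ℝ) ≠ 0 := by exact_mod_cast k.factorial_ne_zero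
  have h01 : (⟨0, by omega⟩ : Fin k) ≠ ⟨1, by omega⟩ := by simp
  rw [pairAverage_eq_perm hk _ h01, pairAverage_eq_perm hk _ h01, Finset.mul_sum, Finset.mul_sum]
  exact Real.rpow_arith_mean_le_arith_mean_rpow _ _ _ (fun _ _ => by positivity)
    (by simp [Finset.card_univ, Fintype.card_perm, hf]) (fun _ _ => h _ _) hr

theorem sq_rpow_half (x p : ℝ) : (x ^ 2) ^ (p / 2) = |x| ^ p := by
  rw [← sq_abs, ← Real.rpow_natCast, ← Real.rpow_mul (abs_nonneg _)]
  congr 1; push_cast; ring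

/-- Chernoff's bound on the event that the (self-normalising) second moments are controlled. -/
theorem measure_pairAverage_le_inter_le {P : Measure Ω} {ν : Measure 𝒳} [IsProbabilityMeasure ν]
    {k : ℕ} (hk : 2 ≤ k) {X : Fin k → Ω → 𝒳} (hX : iIndepFun X P)
    (hm : ∀ i, Measurable (X i)) (hν : ∀ i, P.map (X i) = ν) {F : 𝒳 × 𝒳 → ℝ} (hF : Measurable F)
    (hF2 : MemLp F 2 (ν.prod ν)) {t B : ℝ} (ht : 0 ≤ t) (hB : 0 < B) :
    P {ω | (pairAverage fun i j => F (X i ω, X j ω)) ≤ (∫ q, F q ∂(ν.prod ν)) - t ∧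
        (pairAverage fun i j => F (X i ω, X j ω) ^ 2) + ∫ q, F q ^ 2 ∂(ν.prod ν) ≤ 2 * B}
      ≤ ENNReal.ofReal (Real.exp (-(((k / 2 : ℕ) : ℝ) * t ^ 2 / (4 * B)))) := by
  set M := ∫ q, F q ∂(ν.prod ν)
  set w := ∫ q, F q ^ 2 ∂(ν.prod ν)
  set m := ((k / 2 : ℕ) : ℝ)
  -- This `θ` maximises `θ t - θ² B`.
  set θ := t / (2 * B) with hθ
  have hθ0 : 0 ≤ θ := by positivity
  let G : 𝒳 × 𝒳 → ℝ := fun q => θ * (M - F q) - θ ^ 2 / 2 * (F q ^ 2 + w)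
  have hG : Measurable G := by fun_prop
  have hexp := lintegral_exp_pairAverage_le hk hX hm hν hG (lintegral_exp_selfNormalized_le hF2 θ)
  have hpair : ∀ i j : Fin k, Measurable fun ω => (X i ω, X j ω) := fun i j => (hm i).prodMk (hm j)
  have hGm : Measurable fun ω => pairAverage fun i j => G (X i ω, X j ω) :=
    measurable_pairAverage fun i j => hG.comp (hpair i j)
  have hlin : ∀ ω, (pairAverage fun i j => G (X i ω, X j ω))
      = θ * (M - pairAverage fun i j => F (X i ω, X j ω))
        - θ ^ 2 / 2 * ((pairAverage fun i j => F (X i ω, X j ω) ^ 2) + w) := by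
    intro ω
    have := pairAverage_add_add_const hk (fun i j => F (X i ω, X j ω))
      (fun i j => F (X i ω, X j ω) ^ 2) (-θ) (-(θ ^ 2 / 2)) (θ * M - θ ^ 2 / 2 * w)
    calc _ = pairAverage (fun i j => -θ * F (X i ω, X j ω) + -(θ ^ 2 / 2) * F (X i ω, X j ω) ^ 2
          + (θ * M - θ ^ 2 / 2 * w)) := by
          congr 1; ext i j; simp only [G]; ring
      _ = _ := by rw [this]; ring
  set c := m * t ^ 2 / (4 * B) with hc
  have hc' : c = m * (θ * t - θ ^ 2 * B) := by rw [hc, hθ]; field_simp; ring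
  have hsub : {ω | (pairAverage fun i j => F (X i ω, X j ω)) ≤ M - t ∧
        (pairAverage fun i j => F (X i ω, X j ω) ^ 2) + w ≤ 2 * B}
      ⊆ {ω | ENNReal.ofReal (Real.exp c) ≤
        ENNReal.ofReal (Real.exp (m * pairAverage fun i j => G (X i ω, X j ω)))} := by
    rintro ω ⟨h1, h2⟩
    refine ENNReal.ofReal_le_ofReal (Real.exp_le_exp.2 ?_)
    rw [hc', hlin]
    have h3 : θ * t ≤ θ * (M - pairAverage fun i j => F (X i ω, X j ω)) := by
      gcongr; linarith
    have h4 : θ ^ 2 / 2 * ((pairAverage fun i j => F (X i ω, X j ω) ^ 2) + w)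
        ≤ θ ^ 2 / 2 * (2 * B) := by gcongr
    have hm0 : 0 ≤ m := Nat.cast_nonneg _
    refine mul_le_mul_of_nonneg_left ?_ hm0
    linarith
  refine (measure_mono hsub).trans ?_
  have hpos : 0 < ENNReal.ofReal (Real.exp c) := ENNReal.ofReal_pos.2 (Real.exp_pos _)
  refine (meas_ge_le_lintegral_div (hGm.const_mul m).exp.ennreal_ofReal.aemeasurable hpos.ne'
    ENNReal.ofReal_ne_top).trans ?_
  rw [Real.exp_neg, ENNReal.ofReal_inv_of_pos (Real.exp_pos _), ENNReal.div_eq_inv_mul]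
  exact mul_le_of_le_one_right' hexp

/-- Markov's inequality of order `p / 2` for the empirical second moment. -/
theorem measure_sq_le_pairAverage_sq_le {P : Measure Ω} {ν : Measure 𝒳} [IsProbabilityMeasure ν]
    {k : ℕ} (hk : 2 ≤ k) {X : Fin k → Ω → 𝒳} (hX : iIndepFun X P)
    (hm : ∀ i, Measurable (X i)) (hν : ∀ i, P.map (X i) = ν) {F : 𝒳 × 𝒳 → ℝ} (hF : Measurable F)
    {p : ℝ} (hp : 2 ≤ p) (hFp : Integrable (fun q => |F q| ^ p) (ν.prod ν)) {R : ℝ} (hR : 0 < R) :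
    P {ω | R ^ 2 ≤ pairAverage fun i j => F (X i ω, X j ω) ^ 2}
      ≤ ENNReal.ofReal ((∫ q, |F q| ^ p ∂(ν.prod ν)) / R ^ p) := by
  have hf : (0 : ℝ) < k.factorial := by exact_mod_cast k.factorial_pos
  have h01 : (⟨0, by omega⟩ : Fin k) ≠ ⟨1, by omega⟩ := by simp
  have hpair : ∀ i j : Fin k, Measurable fun ω => (X i ω, X j ω) := fun i j => (hm i).prodMk (hm j)
  have hgm : Measurable fun q => |F q| ^ p := by fun_prop
  have hQ : Measurable fun ω => pairAverage fun i j => |F (X i ω, X j ω)| ^ p :=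
    measurable_pairAverage fun i j => hgm.comp (hpair i j)
  have hsub : {ω | R ^ 2 ≤ pairAverage fun i j => F (X i ω, X j ω) ^ 2}
      ⊆ {ω | ENNReal.ofReal (R ^ p) ≤
        ENNReal.ofReal (pairAverage fun i j => |F (X i ω, X j ω)| ^ p)} := by
    intro ω (hω : R ^ 2 ≤ _)
    refine ENNReal.ofReal_le_ofReal ?_
    calc R ^ p = (R ^ 2) ^ (p / 2) := by rw [sq_rpow_half, abs_of_pos hR]
      _ ≤ (pairAverage fun i j => F (X i ω, X j ω) ^ 2) ^ (p / 2) :=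
        Real.rpow_le_rpow (by positivity) hω (by linarith)
      _ ≤ pairAverage fun i j => (F (X i ω, X j ω) ^ 2) ^ (p / 2) :=
        pairAverage_rpow_le hk (fun _ _ => sq_nonneg _) (by linarith)
      _ = _ := by simp only [sq_rpow_half]
  have hint : ∫⁻ ω, ENNReal.ofReal (pairAverage fun i j => |F (X i ω, X j ω)| ^ p) ∂P
      = ENNReal.ofReal (∫ q, |F q| ^ p ∂(ν.prod ν)) := by
    have hb : ∀ σ : Equiv.Perm (Fin k),
        ∫⁻ ω, ENNReal.ofReal (|F (X (σ ⟨0, by omega⟩) ω, X (σ ⟨1, by omega⟩) ω)| ^ p) ∂P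
          = ENNReal.ofReal (∫ q, |F q| ^ p ∂(ν.prod ν)) := by
      intro σ
      rw [(measurePreserving_pair hX hm hν (σ.injective.ne h01)).lintegral_comp
        (f := fun q => ENNReal.ofReal (|F q| ^ p)) hgm.ennreal_ofReal,
        ofReal_integral_eq_lintegral_ofReal hFp (ae_of_all _ fun q => by positivity)]
    have hmeas : ∀ σ : Equiv.Perm (Fin k), Measurable fun ω =>
        ENNReal.ofReal (|F (X (σ ⟨0, by omega⟩) ω, X (σ ⟨1, by omega⟩) ω)| ^ p) := fun σ =>
      (hgm.comp (hpair _ _)).ennreal_ofReal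
    have hs : ∀ ω, ENNReal.ofReal (pairAverage fun i j => |F (X i ω, X j ω)| ^ p)
        = ENNReal.ofReal (k.factorial : ℝ)⁻¹ * ∑ σ : Equiv.Perm (Fin k),
          ENNReal.ofReal (|F (X (σ ⟨0, by omega⟩) ω, X (σ ⟨1, by omega⟩) ω)| ^ p) := by
      intro ω
      rw [pairAverage_eq_perm hk _ h01, ENNReal.ofReal_mul (by positivity),
        ENNReal.ofReal_sum_of_nonneg fun _ _ => by positivity]
    simp only [hs]
    rw [lintegral_const_mul' _ _ ENNReal.ofReal_ne_top, lintegral_finsetSum _ fun σ _ => hmeas σ]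
    simp only [hb, Finset.sum_const, Finset.card_univ, Fintype.card_perm, Fintype.card_fin,
      nsmul_eq_mul]
    rw [← mul_assoc, ENNReal.ofReal_inv_of_pos hf, ENNReal.ofReal_natCast,
      ENNReal.inv_mul_cancel (by exact_mod_cast k.factorial_ne_zero) (ENNReal.natCast_ne_top _),
      one_mul]
  have hRp : 0 < R ^ p := Real.rpow_pos_of_pos hR _
  refine (measure_mono hsub).trans ?_
  refine (meas_ge_le_lintegral_div hQ.ennreal_ofReal.aemeasurable
    (ENNReal.ofReal_pos.2 hRp).ne' ENNReal.ofReal_ne_top).trans ?_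
  rw [hint, ENNReal.ofReal_div_of_pos hRp]

/-- Jensen's inequality: on a probability space the `L^2` norm is at most the `L^p` norm. -/
theorem integral_sq_le_of_integral_rpow_le {μ : Measure Ω} [IsProbabilityMeasure μ] {F : Ω → ℝ}
    {p A : ℝ} (hp : 2 ≤ p) (hA : 0 ≤ A) (hF2 : Integrable (fun q => F q ^ 2) μ)
    (hFp : Integrable (fun q => |F q| ^ p) μ) (h : ∫ q, |F q| ^ p ∂μ ≤ A ^ p) :
    ∫ q, F q ^ 2 ∂μ ≤ A ^ 2 := by
  have hJ := (convexOn_rpow (p := p / 2) (by linarith)).map_integral_le (μ := μ)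
    (f := fun q => F q ^ 2) (Real.continuous_rpow_const (by linarith)).continuousOn isClosed_Ici
    (ae_of_all _ fun q => sq_nonneg (F q)) hF2
    (by simpa only [Function.comp_def, sq_rpow_half] using hFp)
  simp only [sq_rpow_half] at hJ
  have h2 : (∫ q, F q ^ 2 ∂μ) ^ (p / 2) ≤ (A ^ 2) ^ (p / 2) := by
    rw [sq_rpow_half, abs_of_nonneg hA]; exact hJ.trans h
  exact (Real.rpow_le_rpow_iff (integral_nonneg fun q => sq_nonneg (F q)) (sq_nonneg A)
    (by linarith)).1 h2

/-- Lower tail of the average of `F` over pairs of independent variables, for `F` in `L^p`. -/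
theorem measure_pairAverage_le {P : Measure Ω} {ν : Measure 𝒳} [IsProbabilityMeasure ν]
    {k : ℕ} (hk : 2 ≤ k) {X : Fin k → Ω → 𝒳} (hX : iIndepFun X P)
    (hm : ∀ i, Measurable (X i)) (hν : ∀ i, P.map (X i) = ν) {F : 𝒳 × 𝒳 → ℝ} (hF : Measurable F)
    {p : ℝ} (hp : 2 ≤ p) (hF2 : MemLp F 2 (ν.prod ν))
    (hFp : Integrable (fun q => |F q| ^ p) (ν.prod ν)) {A : ℝ}
    (hA : 0 < A) (hFA : ∫ q, |F q| ^ p ∂(ν.prod ν) ≤ A ^ p) {K t : ℝ} (hK : 1 ≤ K) (ht : 0 ≤ t) :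
    P {ω | (pairAverage fun i j => F (X i ω, X j ω)) ≤ (∫ q, F q ∂(ν.prod ν)) - t}
      ≤ ENNReal.ofReal (Real.exp (-(((k / 2 : ℕ) : ℝ) * t ^ 2 / (4 * (A * K) ^ 2))))
        + ENNReal.ofReal (K ^ (-p)) := by
  have hK0 : 0 < K := by linarith
  have hw := integral_sq_le_of_integral_rpow_le hp hA.le hF2.integrable_sq hFp hFA
  have h1 := measure_pairAverage_le_inter_le hk hX hm hν hF hF2 ht (B := (A * K) ^ 2)
    (by positivity)
  have h2 := measure_sq_le_pairAverage_sq_le hk hX hm hν hF hp hFp (R := A * K) (by positivity)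
  have h3 : (∫ q, |F q| ^ p ∂(ν.prod ν)) / (A * K) ^ p ≤ K ^ (-p) := by
    rw [Real.mul_rpow hA.le hK0.le, Real.rpow_neg hK0.le, div_le_iff₀ (by positivity)]
    have : K ^ p ≠ 0 := (Real.rpow_pos_of_pos hK0 _).ne'
    field_simp
    exact hFA
  refine le_trans ?_ (add_le_add h1 (h2.trans (ENNReal.ofReal_le_ofReal h3)))
  refine le_trans (measure_mono fun ω hω => ?_) (measure_union_le _ _)
  rcases le_or_gt ((A * K) ^ 2) (pairAverage fun i j => F (X i ω, X j ω) ^ 2) with h | h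
  · exact Or.inr h
  · refine Or.inl ⟨hω, ?_⟩
    have : A ^ 2 ≤ (A * K) ^ 2 := by
      rw [mul_pow]; exact le_mul_of_one_le_right (sq_nonneg A) (one_le_pow₀ hK)
    linarith

/-! ### Cut norms of samples -/

variable {Z : Type*} [NormedAddCommGroup Z] [NormedSpace ℝ Z]

theorem realCutNorm_nonneg (W : unitInterval → unitInterval → ℝ) : 0 ≤ realCutNorm W := by
  refine Real.sSup_nonneg ?_
  rintro r ⟨S, T, -, -, rfl⟩
  exact abs_nonneg _

theorem cutNorm_nonneg (W : unitInterval → unitInterval → StrongDual ℝ Z) : 0 ≤ cutNorm W := by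
  refine Real.sSup_nonneg ?_
  rintro r ⟨f, -, rfl⟩
  exact realCutNorm_nonneg _

theorem exists_lt_abs_integral_of_lt_cutNorm {W : unitInterval → unitInterval → StrongDual ℝ Z}
    {v : ℝ} (hv : 0 ≤ v) (h : v < cutNorm W) :
    ∃ (f : Z) (S T : Set unitInterval), ‖f‖ = 1 ∧ MeasurableSet S ∧ MeasurableSet T ∧
      v < |∫ q in S ×ˢ T, W q.1 q.2 f| := by
  -- A real supremum exceeding `v ≥ 0` is not that of the empty set.
  have aux : ∀ s : Set ℝ, v < sSup s → ∃ r ∈ s, v < r := by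
    intro s hs
    refine exists_lt_of_lt_csSup ?_ hs
    by_contra hne
    rw [Set.not_nonempty_iff_eq_empty] at hne
    rw [hne, Real.sSup_empty] at hs
    linarith
  obtain ⟨r, ⟨f, hf, rfl⟩, hr⟩ := aux _ h
  obtain ⟨r, ⟨S, T, hS, hT, rfl⟩, hr⟩ := aux _ hr
  exact ⟨f, S, T, hf, hS, hT, hr⟩

/-- For a bounded `W` both suprema in the cut norm are over bounded sets, so each test is a lower
bound. No measurability is needed: an integral that does not exist is `0`. -/
theorem abs_integral_le_cutNorm {W : unitInterval → unitInterval → StrongDual ℝ Z} {D : ℝ}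
    (hW : ∀ x y, ‖W x y‖ ≤ D) {f : Z} (hf : ‖f‖ = 1) {S T : Set unitInterval}
    (hS : MeasurableSet S) (hT : MeasurableSet T) :
    |∫ q in S ×ˢ T, W q.1 q.2 f| ≤ cutNorm W := by
  have hD : 0 ≤ D := (norm_nonneg _).trans (hW 0 0)
  have hint : ∀ g : Z, ‖g‖ = 1 → ∀ S T : Set unitInterval,
      |∫ q in S ×ˢ T, W q.1 q.2 g| ≤ D := by
    intro g hg S T
    have h1 := norm_setIntegral_le_of_norm_le_const (μ := volume) (s := S ×ˢ T)
      (f := fun q : unitInterval × unitInterval => W q.1 q.2 g) (C := D)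
      (measure_lt_top _ _) fun q _ => by
        have := (W q.1 q.2).le_opNorm g
        rw [hg, mul_one] at this
        exact this.trans (hW _ _)
    rw [Real.norm_eq_abs] at h1
    exact h1.trans (mul_le_of_le_one_right hD measureReal_le_one)
  have hreal : ∀ g : Z, ‖g‖ = 1 → realCutNorm (fun x y => W x y g) ≤ D := by
    intro g hg
    refine Real.sSup_le ?_ hD
    rintro r ⟨S, T, -, -, rfl⟩
    exact hint g hg S T
  calc _ ≤ realCutNorm fun x y => W x y f :=
        le_csSup ⟨D, by rintro r ⟨S, T, -, -, rfl⟩; exact hint f hf S T⟩ ⟨S, T, hS, hT, rfl⟩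
    _ ≤ cutNorm W := le_csSup ⟨D, by rintro r ⟨g, hg, rfl⟩; exact hreal g hg⟩ ⟨f, hf, rfl⟩

theorem step_eq_preimage (k : ℕ) (i : Fin k) :
    step k i = Subtype.val ⁻¹' Set.Ico (((i : ℕ) : ℝ) / k) ((((i : ℕ) : ℝ) + 1) / k) := rfl

theorem measurableSet_step (k : ℕ) (i : Fin k) : MeasurableSet (step k i) := by
  rw [step_eq_preimage]
  exact measurable_subtype_coe measurableSet_Ico

theorem measureReal_step (k : ℕ) (i : Fin k) : volume.real (step k i) = 1 / k := by
  have hi : (((i : ℕ) : ℝ) + 1) ≤ k := by exact_mod_cast i.2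
  have hk : (0 : ℝ) < k := lt_of_lt_of_le (by positivity) hi
  have hsub : Set.Ico (((i : ℕ) : ℝ) / k) ((((i : ℕ) : ℝ) + 1) / k) ⊆ Set.Icc 0 1 := by
    intro x hx
    refine ⟨le_trans (by positivity) hx.1, hx.2.le.trans ?_⟩
    rw [div_le_one hk]; exact hi
  rw [Measure.real, unitInterval.volume_apply, step_eq_preimage, Subtype.image_preimage_val,
    Set.inter_eq_right.2 hsub, Real.volume_Ico, ENNReal.toReal_ofReal]
  · ring
  · rw [← sub_div]
    exact div_nonneg (by linarith) hk.le

theorem eq_of_mem_step {k : ℕ} {i j : Fin k} {s : unitInterval} (hi : s ∈ step k i)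
    (hj : s ∈ step k j) : i = j := by
  have hk : (0 : ℝ) < k := by exact_mod_cast i.pos
  have h1 := (div_lt_div_iff_of_pos_right hk).1 (hi.1.trans_lt hj.2)
  have h2 := (div_lt_div_iff_of_pos_right hk).1 (hj.1.trans_lt hi.2)
  norm_cast at h1 h2
  exact Fin.ext (by omega)

/-- The union of the steps whose sampled point lies in `S`. -/
def sampleSet {k : ℕ} (x : Fin k → unitInterval) (S : Set unitInterval) : Set unitInterval :=
  ⋃ i ∈ {i | x i ∈ S}, step k i

theorem measurableSet_sampleSet {k : ℕ} (x : Fin k → unitInterval) (S : Set unitInterval) :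
    MeasurableSet (sampleSet x S) :=
  MeasurableSet.biUnion (Set.to_countable _) fun i _ => measurableSet_step k i

open scoped Classical in
theorem step_inter_sampleSet {k : ℕ} (x : Fin k → unitInterval) (S : Set unitInterval)
    (i : Fin k) : step k i ∩ sampleSet x S = if x i ∈ S then step k i else ∅ := by
  ext s
  simp only [sampleSet, Set.mem_inter_iff, Set.mem_iUnion, Set.mem_ofPred_eq, exists_prop]
  split_ifs with h
  · exact ⟨fun hs => hs.1, fun hs => ⟨hs, i, h, hs⟩⟩
  · simp only [Set.mem_empty_iff_false, iff_false]
    rintro ⟨hs, j, hj, hs'⟩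
    exact h (eq_of_mem_step hs hs' ▸ hj)

open scoped Classical in
theorem setIntegral_sample {k : ℕ} (hk : 2 ≤ k)
    (U : unitInterval → unitInterval → StrongDual ℝ Z) (x : Fin k → unitInterval) (f : Z)
    (S T : Set unitInterval) :
    ∫ q in sampleSet x S ×ˢ sampleSet x T, sample U x q.1 q.2 f
      = (1 - 1 / k) * pairAverage fun i j =>
        (S ×ˢ T).indicator (fun q => U q.1 q.2 f) (x i, x j) := by
  have hk' : (2 : ℝ) ≤ k := by exact_mod_cast hk
  have hM : ∀ i j, MeasurableSet (step k i ×ˢ step k j) := fun i j =>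
    (measurableSet_step k i).prod (measurableSet_step k j)
  have h1 : ∀ q : unitInterval × unitInterval, sample U x q.1 q.2 f
      = ∑ i : Fin k, ∑ j : Fin k, (step k i ×ˢ step k j).indicator
        (fun _ => if i ≠ j then U (x i) (x j) f else 0) q := by
    intro q
    simp only [sample, _root_.sum_apply]
    refine Finset.sum_congr rfl fun i _ => Finset.sum_congr rfl fun j _ => ?_
    by_cases h : i = j
    · simp [h]
    · by_cases hq : q ∈ step k i ×ˢ step k j
      · rw [Set.indicator_of_mem hq, if_pos ⟨h, hq.1, hq.2⟩, if_pos h]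
      · rw [Set.indicator_of_notMem hq, if_neg fun h' => hq ⟨h'.2.1, h'.2.2⟩]
        simp
  have hi : ∀ i j, IntegrableOn ((step k i ×ˢ step k j).indicator
      (fun _ => if i ≠ j then U (x i) (x j) f else (0 : ℝ)))
      (sampleSet x S ×ˢ sampleSet x T) volume := fun i j =>
    ((integrable_const _).indicator (hM i j)).integrableOn
  simp only [h1]
  rw [integral_finsetSum _ fun i _ => integrable_finsetSum _ fun j _ => hi i j]
  have hk0 : (k : ℝ) ≠ 0 := by linarith
  have hk1 : (k : ℝ) - 1 ≠ 0 := by linarith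
  have hc : (1 - 1 / (k : ℝ)) * ((k : ℝ) * (k - 1))⁻¹ = 1 / k * (1 / k) := by
    field_simp
  rw [pairAverage, ← mul_assoc, hc, Finset.mul_sum]
  refine Finset.sum_congr rfl fun i _ => ?_
  rw [integral_finsetSum _ fun j _ => hi i j, Finset.mul_sum]
  refine Finset.sum_congr rfl fun j _ => ?_
  rw [setIntegral_indicator (hM i j), setIntegral_const, Set.prod_inter_prod,
    Set.inter_comm _ (step k i), Set.inter_comm _ (step k j), step_inter_sampleSet,
    step_inter_sampleSet, Measure.volume_eq_prod, measureReal_prod_prod]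
  by_cases h1 : x i ∈ S <;> by_cases h2 : x j ∈ T <;> by_cases h3 : i = j <;>
    simp [h1, h2, h3, measureReal_step]

/-- A rectangle `S × T` and a vector `f` that test the cut norm of `U` give rise to a rectangle
that tests the cut norm of the sample. -/
theorem abs_pairAverage_le_cutNorm_sample {k : ℕ} (hk : 2 ≤ k)
    (U : unitInterval → unitInterval → StrongDual ℝ Z) (x : Fin k → unitInterval) {f : Z}
    (hf : ‖f‖ = 1) (S T : Set unitInterval) :
    (1 - 1 / (k : ℝ)) * |pairAverage fun i j =>
        (S ×ˢ T).indicator (fun q => U q.1 q.2 f) (x i, x j)| ≤ cutNorm (sample U x) := by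
  classical
  have hk' : (2 : ℝ) ≤ k := by exact_mod_cast hk
  have hD : ∀ s t, ‖sample U x s t‖ ≤ ∑ i : Fin k, ∑ j : Fin k, ‖U (x i) (x j)‖ := by
    intro s t
    refine (norm_sum_le _ _).trans (Finset.sum_le_sum fun i _ => (norm_sum_le _ _).trans
      (Finset.sum_le_sum fun j _ => ?_))
    split_ifs <;> simp
  have h := abs_integral_le_cutNorm hD hf (measurableSet_sampleSet x S)
    (measurableSet_sampleSet x T)
  have h0 : 0 ≤ 1 - 1 / (k : ℝ) := by
    rw [sub_nonneg, div_le_one (by linarith)]; linarith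
  rwa [setIntegral_sample hk, abs_mul, abs_of_nonneg h0] at h

theorem kernelLpNorm_nonneg (p : ℝ) (W : unitInterval → unitInterval → StrongDual ℝ Z) :
    0 ≤ kernelLpNorm p W :=
  Real.rpow_nonneg (integral_nonneg fun _ => Real.rpow_nonneg (norm_nonneg _) _) _

/-! ### Numerical estimates -/

theorem inv_lt_rpow_mul_sqrt_log {k : ℕ} (hk : 2 ≤ k) {γ : ℝ} (hγ : 0 ≤ γ) :
    1 / (k : ℝ) < (k : ℝ) ^ (-(1 / 2) + γ) * Real.sqrt (Real.log k) := by
  have hk' : (2 : ℝ) ≤ k := by exact_mod_cast hk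
  have hk0 : (0 : ℝ) < k := by linarith
  have h1 : 1 / (k : ℝ) < Real.log k := by
    calc 1 / (k : ℝ) ≤ 1 / 2 := one_div_le_one_div_of_le (by norm_num) hk'
      _ < Real.log 2 := by linarith [Real.log_two_gt_d9]
      _ ≤ Real.log k := Real.log_le_log (by norm_num) hk'
  have h2 : Real.sqrt (1 / k) < Real.sqrt (Real.log k) :=
    Real.sqrt_lt_sqrt (by positivity) h1
  have h3 : Real.sqrt (1 / k) ≤ (k : ℝ) ^ (-(1 / 2) + γ) := by
    rw [Real.sqrt_eq_rpow, one_div (k : ℝ), Real.inv_rpow hk0.le, ← Real.rpow_neg hk0.le]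
    exact Real.rpow_le_rpow_of_exponent_le (by linarith) (by linarith)
  have h4 : 0 < Real.sqrt (1 / k) := by positivity
  calc 1 / (k : ℝ) = Real.sqrt (1 / k) * Real.sqrt (1 / k) :=
        (Real.mul_self_sqrt (by positivity)).symm
    _ < Real.sqrt (1 / k) * Real.sqrt (Real.log k) := by gcongr
    _ ≤ _ := by gcongr

/-- The Gaussian exponent at the deviation in question. The powers of `k ^ γ` cancel and leave
`18 ⌊k/2⌋ / k`, which is at least `6`, times `c ln k`. -/
theorem exp_neg_deviation_le {k : ℕ} (hk : 2 ≤ k) {γ A c : ℝ} (hA : 0 < A) (hc : 0 ≤ c) :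
    Real.exp (-(((k / 2 : ℕ) : ℝ) * (Real.sqrt (18 * c) * (2 * A) *
      ((k : ℝ) ^ (-(1 / 2) + γ) * Real.sqrt (Real.log k))) ^ 2 / (4 * (A * (k : ℝ) ^ γ) ^ 2)))
      ≤ (k : ℝ) ^ (-c) := by
  have hk' : (2 : ℝ) ≤ k := by exact_mod_cast hk
  have hk0 : (0 : ℝ) < k := by linarith
  have hlog : 0 ≤ Real.log k := Real.log_nonneg (by linarith)
  have hm : (k : ℝ) ≤ 3 * ((k / 2 : ℕ) : ℝ) := by
    have : k ≤ 3 * (k / 2) := by omega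
    exact_mod_cast this
  rw [Real.rpow_def_of_pos hk0 (-c), Real.exp_le_exp, mul_neg, neg_le_neg_iff]
  have h1 : ((k : ℝ) ^ (-(1 / 2) + γ)) ^ 2 = (k : ℝ)⁻¹ * ((k : ℝ) ^ γ) ^ 2 := by
    rw [Real.rpow_add hk0, mul_pow, ← Real.rpow_natCast ((k : ℝ) ^ (-(1 / 2 : ℝ))),
      ← Real.rpow_mul hk0.le, ← Real.rpow_neg_one]
    norm_num
  have hK : 0 < (k : ℝ) ^ γ := Real.rpow_pos_of_pos hk0 _
  rw [mul_pow, mul_pow, mul_pow ((k : ℝ) ^ _), Real.sq_sqrt (by positivity), Real.sq_sqrt hlog, h1]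
  have h2 : ((k / 2 : ℕ) : ℝ) * (18 * c * (2 * A) ^ 2 *
      ((k : ℝ)⁻¹ * ((k : ℝ) ^ γ) ^ 2 * Real.log k)) / (4 * (A * (k : ℝ) ^ γ) ^ 2)
      = 18 * (((k / 2 : ℕ) : ℝ) / k) * (Real.log k * c) := by
    field_simp; ring
  rw [h2]
  refine le_mul_of_one_le_left (by positivity) ?_
  have h3 : 1 / 3 ≤ ((k / 2 : ℕ) : ℝ) / k := by
    rw [le_div_iff₀ hk0]; linarith
  linarith

/-- For a fixed test vector and a fixed rectangle the sample is unlikely to be much smaller than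
the kernel. -/
theorem measure_sample_deviation_le {P : Measure Ω} {k : ℕ} (hk : 2 ≤ k) {p : ℝ} (hp : 2 < p)
    {U : unitInterval → unitInterval → StrongDual ℝ Z} (hU : IsLpKernel p U)
    {γ : ℝ} (hγ : 1 / p < γ) {X : Fin k → Ω → unitInterval} (hm : ∀ i, Measurable (X i))
    (hX : iIndepFun X P) (hν : ∀ i, P.map (X i) = volume)
    {f : Z} (hf : ‖f‖ = 1) {S T : Set unitInterval} (hS : MeasurableSet S) (hT : MeasurableSet T)
    (hpos : 0 < |∫ q in S ×ˢ T, U q.1 q.2 f|) :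
    P {ω | |pairAverage fun i j =>
        (S ×ˢ T).indicator (fun q => U q.1 q.2 f) (X i ω, X j ω)|
          ≤ |∫ q in S ×ˢ T, U q.1 q.2 f| - Real.sqrt (18 * (γ * p - 1)) *
            (2 * kernelLpNorm p U) * ((k : ℝ) ^ (-(1 / 2) + γ) * Real.sqrt (Real.log k))}
      ≤ ENNReal.ofReal (3 * (k : ℝ) ^ (1 - γ * p)) := by
  have hk' : (2 : ℝ) ≤ k := by exact_mod_cast hk
  have hk0 : (0 : ℝ) < k := by linarith
  have hp0 : 0 < p := by linarith
  have hγ0 : 0 < γ := lt_trans (by positivity) hγ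
  have hc : 0 < γ * p - 1 := by rw [div_lt_iff₀ hp0] at hγ; linarith
  set A := kernelLpNorm p U with hAdef
  set r := |∫ q in S ×ˢ T, U q.1 q.2 f| with hr
  set h := (S ×ˢ T).indicator fun q : unitInterval × unitInterval => U q.1 q.2 f with hh
  -- The sign makes the integral of `u` nonnegative.
  obtain ⟨ε, hε, hεr⟩ : ∃ ε : ℝ, |ε| = 1 ∧ ε * ∫ q in S ×ˢ T, U q.1 q.2 f = r := by
    rcases le_total 0 (∫ q in S ×ˢ T, U q.1 q.2 f) with h0 | h0
    · exact ⟨1, by simp, by rw [hr, abs_of_nonneg h0, one_mul]⟩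
    · exact ⟨-1, by simp, by rw [hr, abs_of_nonpos h0, neg_one_mul]⟩
  have hum : AEMeasurable (fun q => ε * h q) volume :=
    ((hU.weakStar_measurable f).indicator (hS.prod hT)).const_mul ε
  -- A Borel version of the test function, to which independence can be applied.
  set F := hum.mk _
  have hFm : Measurable F := hum.measurable_mk
  have hFu : (fun q => ε * h q) =ᵐ[volume] F := hum.ae_eq_mk
  have hFU : ∀ᵐ q : unitInterval × unitInterval, |F q| ≤ ‖U q.1 q.2‖ := by
    filter_upwards [hFu] with q hq
    rw [← hq, abs_mul, hε, one_mul, hh, ← Real.norm_eq_abs]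
    refine (norm_indicator_le_norm_self _ _).trans ?_
    simpa [hf] using (U q.1 q.2).le_opNorm f
  have hMemp : MemLp F (ENNReal.ofReal p) volume :=
    hU.memLp.mono hFm.aestronglyMeasurable (by simpa using hFU)
  have hMem2 : MemLp F 2 volume := hMemp.mono_exponent (by
    rw [← ENNReal.ofReal_ofNat]; exact ENNReal.ofReal_le_ofReal hp.le)
  have hUp : Integrable (fun q : unitInterval × unitInterval => ‖U q.1 q.2‖ ^ p) volume := by
    have := hU.memLp.integrable_norm_rpow (by simpa using hp0) ENNReal.ofReal_ne_top
    simpa [ENNReal.toReal_ofReal hp0.le] using this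
  have hFp : Integrable (fun q => |F q| ^ p) volume := by
    have := hMemp.integrable_norm_rpow (by simpa using hp0) ENNReal.ofReal_ne_top
    simpa [ENNReal.toReal_ofReal hp0.le] using this
  have hUI : 0 ≤ ∫ q : unitInterval × unitInterval, ‖U q.1 q.2‖ ^ p :=
    integral_nonneg fun _ => Real.rpow_nonneg (norm_nonneg _) _
  have hAp : A ^ p = ∫ q : unitInterval × unitInterval, ‖U q.1 q.2‖ ^ p := by
    rw [hAdef, kernelLpNorm, ← Real.rpow_mul hUI, one_div_mul_cancel hp0.ne', Real.rpow_one]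
  have hFA : ∫ q, |F q| ^ p ≤ A ^ p := by
    rw [hAp]
    refine integral_mono_ae hFp hUp ?_
    filter_upwards [hFU] with q hq
    exact Real.rpow_le_rpow (abs_nonneg _) hq hp0.le
  have hFint : ∫ q, F q = r := by
    rw [← integral_congr_ae hFu, integral_const_mul, hh, integral_indicator (hS.prod hT), hεr]
  -- If `‖U‖_p = 0` then `F = 0` almost everywhere, against `r > 0`.
  have hA : 0 < A := by
    refine lt_of_le_of_ne (kernelLpNorm_nonneg p U) fun h0 => ?_
    have h1 := integral_sq_le_of_integral_rpow_le hp.le (kernelLpNorm_nonneg p U)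
      hMem2.integrable_sq hFp hFA
    rw [← hAdef, ← h0] at h1
    have h2 : ∫ q, F q ^ 2 = 0 :=
      le_antisymm (by simpa using h1) (integral_nonneg fun q => sq_nonneg _)
    rw [integral_eq_zero_iff_of_nonneg (fun q => sq_nonneg _) hMem2.integrable_sq] at h2
    have h3 : ∫ q, F q = 0 := by
      rw [integral_congr_ae (g := fun _ => (0 : ℝ)), integral_zero]
      filter_upwards [h2] with q hq
      simpa using hq
    linarith
  set t := Real.sqrt (18 * (γ * p - 1)) * (2 * A) *
    ((k : ℝ) ^ (-(1 / 2) + γ) * Real.sqrt (Real.log k)) with ht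
  have ht0 : 0 ≤ t := by positivity
  have hK : 1 ≤ (k : ℝ) ^ γ := Real.one_le_rpow (by linarith) hγ0.le
  have hmain := measure_pairAverage_le hk hX hm hν hFm hp.le hMem2 hFp hA hFA hK ht0
  rw [← Measure.volume_eq_prod, hFint] at hmain
  have hae : ∀ᵐ ω ∂P, ∀ i j : Fin k, i ≠ j → ε * h (X i ω, X j ω) = F (X i ω, X j ω) := by
    rw [ae_all_iff]; intro i
    rw [ae_all_iff]; intro j
    by_cases hij : i = j
    · simp [hij]
    · have := (measurePreserving_pair hX hm hν hij).quasiMeasurePreserving.ae_eq_comp hFu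
      filter_upwards [this] with ω hω _
      exact hω
  have hmono : P {ω | |pairAverage fun i j => h (X i ω, X j ω)| ≤ r - t}
      ≤ P {ω | (pairAverage fun i j => F (X i ω, X j ω)) ≤ r - t} := by
    refine measure_mono_ae ?_
    filter_upwards [hae] with ω hω hle
    have h1 : (pairAverage fun i j => F (X i ω, X j ω))
        = ε * pairAverage fun i j => h (X i ω, X j ω) := by
      simp only [pairAverage, Finset.mul_sum]
      refine Finset.sum_congr rfl fun i _ => Finset.sum_congr rfl fun j _ => ?_
      split_ifs with hij
      · rw [← hω i j hij]; ring
      · simp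
    change (pairAverage fun i j => F (X i ω, X j ω)) ≤ r - t
    rw [h1]
    refine (le_abs_self _).trans ?_
    rw [abs_mul, hε, one_mul]
    exact hle
  refine hmono.trans (hmain.trans ?_)
  rw [← ENNReal.ofReal_add (Real.exp_pos _).le (by positivity)]
  refine ENNReal.ofReal_le_ofReal ?_
  have e1 := exp_neg_deviation_le hk (γ := γ) hA hc.le
  have e2 : ((k : ℝ) ^ γ) ^ (-p) ≤ (k : ℝ) ^ (1 - γ * p) := by
    rw [← Real.rpow_mul hk0.le]
    exact Real.rpow_le_rpow_of_exponent_le (by linarith) (by linarith)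
  rw [neg_sub] at e1
  have e3 : 0 < (k : ℝ) ^ (1 - γ * p) := Real.rpow_pos_of_pos hk0 _
  linarith

end VectorKernel


theorem mainTheorem5
    {Z : Type*} [NormedAddCommGroup Z] [NormedSpace ℝ Z] [CompleteSpace Z]
    [TopologicalSpace.SeparableSpace Z]
    {Ω : Type*} [MeasurableSpace Ω] (P : Measure Ω) [IsProbabilityMeasure P]
    (k : ℕ) (hk : 2 ≤ k) (p : ℝ) (hp : 2 < p)
    (U : unitInterval → unitInterval → StrongDual ℝ Z) (hU : VectorKernel.IsLpKernel p U)
    (γ : ℝ) (hγ : γ ∈ Set.Ioo (1 / p) (1 / 2))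
    (X : Fin k → Ω → unitInterval) (hX_meas : ∀ i, Measurable (X i))
    (hX_indep : iIndepFun X P) (hX_unif : ∀ i, P.map (X i) = volume) :
    ∃ E : Set Ω, MeasurableSet E ∧ 1 - 3 * (k : ℝ) ^ (1 - γ * p) ≤ P.real E ∧
      ∀ ω ∈ E,
        VectorKernel.cutNorm (VectorKernel.sample U (fun i => X i ω)) - VectorKernel.cutNorm U ≥
          -(VectorKernel.cutNorm U + Real.sqrt (18 * (γ * p - 1)) *
              (VectorKernel.kernelLpNorm 1 U + 2 * VectorKernel.kernelLpNorm p U)) *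
            (k : ℝ) ^ (-(1 / 2) + γ) * Real.sqrt (Real.log k) := by
  have hk' : (2 : ℝ) ≤ k := by exact_mod_cast hk
  have hk0 : (0 : ℝ) < k := by linarith
  have hγ0 : 0 < γ := lt_trans (one_div_pos.2 (by linarith)) hγ.1
  set C := VectorKernel.cutNorm U with hC
  have hC0 : 0 ≤ C := VectorKernel.cutNorm_nonneg U
  have hN1 := VectorKernel.kernelLpNorm_nonneg 1 U
  have hNp := VectorKernel.kernelLpNorm_nonneg p U
  set a := (k : ℝ) ^ (-(1 / 2) + γ) * Real.sqrt (Real.log k) with ha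
  have ha1 : 1 / (k : ℝ) < a := VectorKernel.inv_lt_rpow_mul_sqrt_log hk hγ0.le
  have ha0 : 0 < a := lt_trans (by positivity) ha1
  simp only [mul_assoc _ ((k : ℝ) ^ (-(1 / 2) + γ)) _, ← ha]
  have hsq := Real.sqrt_nonneg (18 * (γ * p - 1))
  have hδ : 0 < 3 * (k : ℝ) ^ (1 - γ * p) := by positivity
  rcases hC0.eq_or_lt with h0 | hCpos
  · refine ⟨Set.univ, MeasurableSet.univ, by simpa using hδ.le, fun ω _ => ?_⟩
    have h1 := VectorKernel.cutNorm_nonneg (VectorKernel.sample U fun i => X i ω)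
    rw [← h0]
    have : 0 ≤ (0 + Real.sqrt (18 * (γ * p - 1)) *
        (VectorKernel.kernelLpNorm 1 U + 2 * VectorKernel.kernelLpNorm p U)) * a := by positivity
    linarith
  -- The expectation of the sample loses `C / k` on the diagonal; since `1 / k < a`, there is room
  -- left for a test `(f, S, T)` that is only nearly optimal.
  · have hη : 0 < C * (a - 1 / k) := mul_pos hCpos (sub_pos.2 ha1)
    obtain ⟨f, S, T, hf, hS, hT, hr⟩ := VectorKernel.exists_lt_abs_integral_of_lt_cutNorm
      (W := U) (le_max_left 0 (C - C * (a - 1 / k)))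
      (max_lt hCpos (by linarith))
    have hr0 := (le_max_left _ _).trans_lt hr
    have hr1 := (le_max_right _ _).trans_lt hr
    have hbad := VectorKernel.measure_sample_deviation_le hk hp hU hγ.1 hX_meas hX_indep hX_unif
      hf hS hT hr0
    rw [← ha] at hbad
    set r := |∫ q in S ×ˢ T, U q.1 q.2 f|
    set t := Real.sqrt (18 * (γ * p - 1)) * (2 * VectorKernel.kernelLpNorm p U) * a with ht
    have ht0 : 0 ≤ t := by positivity
    set B := {ω | |VectorKernel.pairAverage fun i j =>
        (S ×ˢ T).indicator (fun q => U q.1 q.2 f) (X i ω, X j ω)| ≤ r - t}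
    refine ⟨(toMeasurable P B)ᶜ, (measurableSet_toMeasurable P B).compl, ?_, fun ω hω => ?_⟩
    · rw [probReal_compl_eq_one_sub (measurableSet_toMeasurable P B)]
      have : P.real (toMeasurable P B) ≤ 3 * (k : ℝ) ^ (1 - γ * p) := by
        rw [Measure.real, measure_toMeasurable]
        exact ENNReal.toReal_le_of_le_ofReal hδ.le hbad
      linarith
    · have hH : r - t < |VectorKernel.pairAverage fun i j =>
          (S ×ˢ T).indicator (fun q => U q.1 q.2 f) (X i ω, X j ω)| :=
        lt_of_not_ge fun h => hω (subset_toMeasurable P B h)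
      have hs := VectorKernel.abs_pairAverage_le_cutNorm_sample hk U (fun i => X i ω) hf S T
      have hk1 : 0 < 1 / (k : ℝ) := by positivity
      have hk2 : 1 / (k : ℝ) ≤ 1 := by rw [div_le_one hk0]; linarith
      have hmul := mul_le_mul_of_nonneg_left hH.le (sub_nonneg.2 hk2)
      have hmul2 := mul_le_mul_of_nonneg_left hr1.le (sub_nonneg.2 hk2)
      have htd : t ≤ Real.sqrt (18 * (γ * p - 1)) *
          (VectorKernel.kernelLpNorm 1 U + 2 * VectorKernel.kernelLpNorm p U) * a := by
        rw [ht]; gcongr; linarith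
      have hkt := mul_nonneg hk1.le ht0
      have hkη := mul_nonneg hk1.le hη.le
      linarith
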